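/- \textbf{Theorem.} Let $\mathcal{E}$ be an elementary topos, that is, a (locally small) category with all finite limits which is cartesian closed and has a subobject classifier. Let $Ab(\mathcal{E})$ be the category of abelian group objects in $\mathcal{E}$: its objects are quadruples $(G, e, i, m)$ with $G$ an object of $\mathcal{E}$ and $e\colon 1 \to G$, $i\colon G \to G$, $m\colon G \times G \to G$ morphisms of $\mathcal{E}$ satisfying the (diagrammatic) axioms of an abelian group, and its morphisms $(G,e,i,m)\to(G',e',i',m')$ are the morphisms $h\colon G \to G'$ of $\mathcal{E}$ with $h\circ e = e'$, $h\circ i = i'\circ h$ and $h\circ m = m'\circ(h\times h)$. Then $Ab(\mathcal{E})$ is an abelian category: it is an additive category (preadditive, i.e. its Hom-sets carry abelian group structures for which composition is bilinear, with a zero object and binary biproducts), every morphism has a kernel and a cokernel, every monomorphism is a kernel, and every epimorphism is a cokernel. -/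

import Mathlib

open CategoryTheory Limits

universe v u

/-!
# Abelian group objects in an elementary topos form an abelian category

The additive structure, finite products and kernels of `CommGrp E` only need finite limits in `E`.
The topos structure is used for cokernels and for normality, through the following facts, in which
the power object of `B` is the exponential `Ω ^ B`.

* For an epimorphism `q : B ⟶ Q`, sending an element of `Q` to its fibre, a subobject of `B`, is a
  monomorphism (`mono_fibre`); its composite with `q` depends only on the kernel pair of `q`
  (`comp_fibre_eq`).
* Every morphism factors as an epimorphism followed by a monomorphism (`exists_epi_mono_fac`): the
  image is the intersection of all the subobjects of the codomain containing the morphism.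
* Hence every epimorphism is the coequalizer of its kernel pair (`exists_desc`), and a morphism out
  of a quotient is a monomorphism as soon as it identifies nothing new (`mono_of_kernelPair_le`).
* Coequalizers of `s` and `t` exist (`exists_coequalizer`): two elements are to be identified when
  they belong to the same subobjects invariant under `s` and `t`.

The cokernel of `f : A ⟶ B` is the coequalizer of the translation action of `A` on `B` and the
projection; its group structure descends from `B` (`exists_cokernel`). A monomorphism is the kernel
of its cokernel because the coset morphism `B ⟶ Ω ^ B` factors through the cokernel
(`exists_lift_of_comp_cokernel`). An epimorphism `e` factors through the cokernel of its kernel by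
a morphism which is an epimorphism, and a monomorphism by comparison of kernel pairs; it is
therefore an isomorphism, and `e` is a cokernel.

Throughout, a morphism `T ⟶ X` is treated as a generalized element of `X`, and the generalized
elements of a group object form a group, written multiplicatively.
-/

namespace ElementaryTopos

open MonoidalCategory CartesianMonoidalCategory MonoidalClosed HasSubobjectClassifier

variable {E : Type u} [Category.{v} E]

section Topos

/-! ### Truth values -/

section Classifier

variable [HasSubobjectClassifier E]

variable (E) in
/-- The morphism `T ⟶ Ω` with constant value "true". -/
noncomputable def trueAt (T : E) : T ⟶ Ω E :=
  Subobject.Classifier.χ₀ _ T ≫ truth E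

@[simp]
lemma comp_trueAt {S T : E} (f : S ⟶ T) : f ≫ trueAt E T = trueAt E S := by
  rw [trueAt, ← Category.assoc]
  exact congrArg (· ≫ truth E) (Subsingleton.elim _ _)

/-- A generalized element satisfies the characteristic morphism of a subobject iff it belongs to
that subobject. -/
lemma comp_χ_eq_trueAt_iff {S X T : E} (m : S ⟶ X) [Mono m] (x : T ⟶ X) :
    x ≫ χ m = trueAt E T ↔ ∃ y : T ⟶ S, y ≫ m = x :=
  ⟨fun h ↦ ⟨(isPullback_χ m).lift x _ h, (isPullback_χ m).lift_fst _ _ _⟩, by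
    rintro ⟨y, rfl⟩
    rw [Category.assoc, HasSubobjectClassifier.comm, ← trueAt, comp_trueAt]⟩

/-- Morphisms into `Ω` that are true at the same generalized elements are equal. -/
lemma hom_Ω_ext [HasPullbacks E] {X : E} {a b : X ⟶ Ω E}
    (h : ∀ (T : E) (x : T ⟶ X), x ≫ a = trueAt E T ↔ x ≫ b = trueAt E T) : a = b := by
  -- any such predicate is the characteristic morphism of the subobject classified by `a`
  have key : ∀ c : X ⟶ Ω E, (∀ (T : E) (x : T ⟶ X), x ≫ a = trueAt E T ↔ x ≫ c = trueAt E T) →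
      c = χ (pullback.fst a (truth E)) := by
    intro c hc
    have hw : pullback.fst a (truth E) ≫ c = Subobject.Classifier.χ₀ _ _ ≫ truth E := by
      refine (hc _ _).1 ?_
      rw [pullback.condition, trueAt]
      exact congrArg (· ≫ truth E) (Subsingleton.elim _ _)
    refine unique _ c ⟨⟨hw⟩, ⟨PullbackCone.IsLimit.mk hw
      (fun s ↦ pullback.lift s.fst s.snd ?_) (fun s ↦ pullback.lift_fst _ _ _)
      (fun s ↦ Subsingleton.elim _ _) (fun s m h₁ _ ↦ ?_)⟩⟩
    · have : s.snd = Subobject.Classifier.χ₀ _ _ := Subsingleton.elim _ _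
      rw [this]
      refine (hc _ _).2 ?_
      rw [s.condition, this, trueAt]
    · rw [← cancel_mono (pullback.fst a (truth E)), pullback.lift_fst, h₁]
  rw [key a fun _ _ ↦ Iff.rfl, ← key b h]

/-- The characteristic morphism of the diagonal: the internal equality predicate. -/
noncomputable def eqPred [CartesianMonoidalCategory E] (X : E) : X ⊗ X ⟶ Ω E :=
  have : Mono (lift (𝟙 X) (𝟙 X)) := mono_of_mono_fac (lift_fst (𝟙 X) (𝟙 X))
  χ (lift (𝟙 X) (𝟙 X))

lemma lift_comp_eqPred_iff [CartesianMonoidalCategory E] {X T : E} (x y : T ⟶ X) :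
    lift x y ≫ eqPred X = trueAt E T ↔ x = y := by
  have : Mono (lift (𝟙 X) (𝟙 X)) := mono_of_mono_fac (lift_fst (𝟙 X) (𝟙 X))
  rw [eqPred, comp_χ_eq_trueAt_iff]
  constructor
  · rintro ⟨z, hz⟩
    have h₁ := congrArg (· ≫ fst X X) hz
    have h₂ := congrArg (· ≫ snd X X) hz
    simp only [Category.assoc, lift_fst, lift_snd, Category.comp_id] at h₁ h₂
    exact h₁.symm.trans h₂
  · rintro rfl
    exact ⟨x, by simp⟩

end Classifier

/-! ### Epimorphisms in a cartesian closed category -/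

section Closed

variable [CartesianMonoidalCategory E] [MonoidalClosed E]

instance epi_whiskerLeft {X Y : E} (A : E) (q : X ⟶ Y) [Epi q] : Epi (A ◁ q) :=
  inferInstanceAs (Epi ((tensorLeft A).map q))

variable [BraidedCategory E]

instance epi_whiskerRight {X Y : E} (A : E) (q : X ⟶ Y) [Epi q] : Epi (q ▷ A) := by
  have : q ▷ A = (β_ X A).hom ≫ A ◁ q ≫ (β_ A Y).hom := by simp
  rw [this]
  infer_instance

instance epi_tensorHom {X Y X' Y' : E} (p : X ⟶ X') (q : Y ⟶ Y') [Epi p] [Epi q] :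
    Epi (p ⊗ₘ q) := by
  rw [MonoidalCategory.tensorHom_def]
  infer_instance

end Closed

variable [CartesianMonoidalCategory E] [BraidedCategory E] [HasFiniteLimits E] [MonoidalClosed E]
  [HasSubobjectClassifier E]

/-! ### Fibres and images -/

/-- For `q : B ⟶ Q`, the morphism from `Q` to the power object of `B` that sends an element
of `Q` to its fibre under `q`. -/
noncomputable def fibre {B Q : E} (q : B ⟶ Q) : Q ⟶ (ihom B).obj (Ω E) :=
  curry (q ▷ Q ≫ eqPred Q)

/-- If `q` is an epimorphism then precomposition with `q ▷ T` is injective, so an element is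
determined by its fibre. -/
instance mono_fibre {B Q : E} (q : B ⟶ Q) [Epi q] : Mono (fibre q) where
  right_cancellation {T} x y h := by
    rw [fibre, ← curry_natural_left, ← curry_natural_left] at h
    have h := curry_injective h
    rw [← Category.assoc, ← Category.assoc, whisker_exchange, whisker_exchange, Category.assoc,
      Category.assoc, cancel_epi] at h
    have h := congrArg (lift x (𝟙 T) ≫ ·) h
    simp only [← Category.assoc, lift_whiskerLeft, Category.id_comp] at h
    rw [(lift_comp_eqPred_iff x x).2 rfl] at h
    exact (lift_comp_eqPred_iff x y).1 h.symm

omit [BraidedCategory E] in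
/-- Morphisms out of `B` with the same kernel pair have the same fibres over elements of `B`. -/
lemma comp_fibre_eq {B Q R : E} (q : B ⟶ Q) (r : B ⟶ R)
    (h : ∀ (T : E) (x y : T ⟶ B), x ≫ q = y ≫ q ↔ x ≫ r = y ≫ r) :
    q ≫ fibre q = r ≫ fibre r := by
  rw [fibre, fibre, ← curry_natural_left, ← curry_natural_left]
  congr 1
  refine hom_Ω_ext fun T z ↦ ?_
  obtain ⟨x, y, rfl⟩ : ∃ x y, z = lift x y := ⟨z ≫ fst _ _, z ≫ snd _ _, by simp⟩
  simpa [← Category.assoc, lift_comp_eqPred_iff] using h T x y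

/-- The tautological predicate on `W ⊗ B`, for `W` a family of subobjects of `B`. -/
noncomputable def mem {B W : E} (w : W ⟶ (ihom B).obj (Ω E)) : W ⊗ B ⟶ Ω E :=
  (β_ W B).hom ≫ uncurry w

omit [HasFiniteLimits E] in
lemma lift_comp_whiskerLeft_mem {B W T : E} (w : W ⟶ (ihom B).obj (Ω E)) (x : T ⟶ W)
    (b : T ⟶ B) : lift x (𝟙 T) ≫ W ◁ b ≫ mem w = lift b (𝟙 T) ≫ uncurry (x ≫ w) := by
  rw [uncurry_natural_left, mem]
  simp [← Category.assoc]

/-- Image factorization. The image of `f : A ⟶ B` is the intersection of all the subobjects of `B`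
that contain `f`, which is an equalizer of morphisms between power objects. -/
theorem exists_epi_mono_fac {A B : E} (f : A ⟶ B) :
    ∃ (I : E) (p : A ⟶ I) (m : I ⟶ B), Epi p ∧ Mono m ∧ p ≫ m = f := by
  -- `W` is the object of those subobjects of `B` whose inverse image under `f` is all of `A`
  let W := equalizer ((pre f).app (Ω E)) (curry (trueAt E (A ⊗ (ihom B).obj (Ω E))))
  let w : W ⟶ (ihom B).obj (Ω E) := equalizer.ι _ _
  have hw : f ▷ W ≫ uncurry w = trueAt E _ := by
    rw [← uncurry_pre_app, equalizer.condition, uncurry_natural_left, uncurry_curry, comp_trueAt]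
  let m := equalizer.ι (curry (mem w)) (curry (trueAt E (W ⊗ B)))
  have fac_iff : ∀ {T : E} (b : T ⟶ B),
      b ≫ curry (mem w) = b ≫ curry (trueAt E (W ⊗ B)) ↔ W ◁ b ≫ mem w = trueAt E _ := by
    intro T b
    rw [← curry_natural_left, ← curry_natural_left, comp_trueAt, curry_injective.eq_iff]
  have hf : f ≫ curry (mem w) = f ≫ curry (trueAt E (W ⊗ B)) := by
    rw [fac_iff, mem, ← Category.assoc, BraidedCategory.braiding_naturality_right,
      Category.assoc, hw, comp_trueAt]
  -- every subobject of `B` containing `f` is an element of `W`, hence contains the image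
  have minimal : ∀ {S : E} (s : S ⟶ B) [Mono s] (g : A ⟶ S), g ≫ s = f → ∃ r, r ≫ s = m := by
    intro S s _ g hg
    let U : B ⊗ equalizer (curry (mem w)) (curry (trueAt E (W ⊗ B))) ⟶ Ω E := fst _ _ ≫ χ s
    have hU : curry U ≫ (pre f).app (Ω E) =
        curry U ≫ curry (trueAt E (A ⊗ (ihom B).obj (Ω E))) := by
      rw [curry_pre_app, ← curry_natural_left, comp_trueAt]
      congr 1
      rw [whiskerRight_fst_assoc, (comp_χ_eq_trueAt_iff s f).2 ⟨g, hg⟩, comp_trueAt]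
    let a : _ ⟶ W := equalizer.lift (curry U) hU
    have ha : a ≫ w = curry U := equalizer.lift_ι _ _
    have h := congrArg (lift a (𝟙 _) ≫ ·) ((fac_iff m).1 (equalizer.condition _ _))
    rw [comp_trueAt, lift_comp_whiskerLeft_mem, ha, uncurry_curry, lift_fst_assoc] at h
    exact (comp_χ_eq_trueAt_iff s m).1 h
  refine ⟨_, equalizer.lift f hf, m, ⟨fun {Z} h k hhk ↦ ?_⟩, inferInstance, equalizer.lift_ι _ _⟩
  obtain ⟨r, hr⟩ := minimal (equalizer.ι h k ≫ m) (equalizer.lift _ hhk) (by simp [m])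
  have hr : r ≫ equalizer.ι h k = 𝟙 _ := by
    rw [← cancel_mono m, Category.assoc, hr, Category.id_comp]
  rw [← Category.id_comp h, ← Category.id_comp k, ← hr, Category.assoc, Category.assoc,
    equalizer.condition]

/-! ### Descent along epimorphisms and coequalizers -/

/-- Every epimorphism is the coequalizer of its kernel pair: a morphism that identifies the
generalized elements identified by the epimorphism `q` factors through `q`. -/
theorem exists_desc {B Q X : E} (q : B ⟶ Q) [Epi q] (g : B ⟶ X)
    (h : ∀ (T : E) (x y : T ⟶ B), x ≫ q = y ≫ q → x ≫ g = y ≫ g) : ∃ u, q ≫ u = g := by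
  -- the image of `(q, g)` is the graph of the required morphism
  obtain ⟨I, p, m, _, _, hp⟩ := exists_epi_mono_fac (lift q g)
  have hq : p ≫ m ≫ fst Q X = q := by rw [← Category.assoc, hp, lift_fst]
  have hg : p ≫ m ≫ snd Q X = g := by rw [← Category.assoc, hp, lift_snd]
  have hfib : p ≫ fibre p = q ≫ fibre q := by
    refine comp_fibre_eq p q fun T x y ↦ ⟨fun e ↦ ?_, fun e ↦ ?_⟩
    · rw [← hq, ← Category.assoc, e, Category.assoc]
    · rw [← cancel_mono m, Category.assoc, Category.assoc, hp, comp_lift, comp_lift, e, h T x y e]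
  have : Mono (m ≫ fst Q X) := by
    have : (m ≫ fst Q X) ≫ fibre q = fibre p := by
      rw [← cancel_epi p, hfib, ← Category.assoc, hq]
    exact mono_of_mono_fac this
  have : Epi (m ≫ fst Q X) := epi_of_epi_fac hq
  have : IsIso (m ≫ fst Q X) := isIso_of_mono_of_epi _
  refine ⟨inv (m ≫ fst Q X) ≫ m ≫ snd Q X, ?_⟩
  rw [← hg]
  nth_rw 1 [← hq]
  rw [Category.assoc, IsIso.hom_inv_id_assoc]

/-- If `q` is an epimorphism whose kernel pair contains that of `q ≫ g`, then `g` is a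
monomorphism. -/
theorem mono_of_kernelPair_le {A Q B : E} (q : A ⟶ Q) [Epi q] (g : Q ⟶ B)
    (h : ∀ (T : E) (x y : T ⟶ A), x ≫ q ≫ g = y ≫ q ≫ g → x ≫ q = y ≫ q) : Mono g := by
  obtain ⟨I, p, m, _, _, hp⟩ := exists_epi_mono_fac (q ≫ g)
  obtain ⟨u, hu⟩ := exists_desc p q fun T x y e ↦ h T x y (by simp [← hp, reassoc_of% e])
  obtain ⟨t, ht⟩ := exists_desc q p fun T x y e ↦ by
    rw [← cancel_mono m, Category.assoc, Category.assoc, hp, reassoc_of% e]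
  have htu : t ≫ u = 𝟙 Q := by rw [← cancel_epi q, ← Category.assoc, ht, hu, Category.comp_id]
  have : Mono t := mono_of_mono_fac htu
  have : g = t ≫ m := by rw [← cancel_epi q, ← Category.assoc, ht, hp]
  rw [this]
  infer_instance

/-- Coequalizers. The coequalizer of `s t : X ⟶ B` is the image of the morphism sending `b : B`
to the family of those subobjects that contain `b` and have the same inverse image under `s` and
`t`: a morphism `g` coequalizing `s` and `t` has invariant fibres, so it identifies elements of `B`
that belong to the same invariant subobjects. -/
theorem exists_coequalizer {X B : E} (s t : X ⟶ B) :
    ∃ (Q : E) (q : B ⟶ Q), Epi q ∧ s ≫ q = t ≫ q ∧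
      ∀ {Z : E} (g : B ⟶ Z), s ≫ g = t ≫ g → ∃ u, q ≫ u = g := by
  let W := equalizer ((pre s).app (Ω E)) ((pre t).app (Ω E))
  let w : W ⟶ (ihom B).obj (Ω E) := equalizer.ι _ _
  have hw : s ▷ W ≫ uncurry w = t ▷ W ≫ uncurry w := by
    rw [← uncurry_pre_app, equalizer.condition, uncurry_pre_app]
  have hst : s ≫ curry (mem w) = t ≫ curry (mem w) := by
    rw [← curry_natural_left, ← curry_natural_left, mem, ← Category.assoc, ← Category.assoc,
      BraidedCategory.braiding_naturality_right, BraidedCategory.braiding_naturality_right,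
      Category.assoc, Category.assoc, hw]
  obtain ⟨Q, q, m, _, _, hq⟩ := exists_epi_mono_fac (curry (mem w))
  refine ⟨Q, q, inferInstance, ?_, fun {Z} g hg ↦ exists_desc q g fun T x y hxy ↦ ?_⟩
  · rw [← cancel_mono m, Category.assoc, Category.assoc, hq, hst]
  · have hmem : W ◁ x ≫ mem w = W ◁ y ≫ mem w := by
      apply curry_injective
      rw [curry_natural_left, curry_natural_left, ← hq, reassoc_of% hxy]
    -- the fibre of `g` through `x` is an invariant subobject
    have hinv : (x ≫ g ≫ fibre g) ≫ (pre s).app (Ω E) = (x ≫ g ≫ fibre g) ≫ (pre t).app (Ω E) := by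
      apply uncurry_injective
      rw [uncurry_pre_app, uncurry_pre_app, fibre, ← curry_natural_left, ← curry_natural_left,
        uncurry_curry]
      simp only [← Category.assoc]
      congr 1
      rw [← whisker_exchange, ← whisker_exchange]
      ext <;> simp [hg]
    let a : T ⟶ W := equalizer.lift _ hinv
    have ha : a ≫ w = x ≫ g ≫ fibre g := equalizer.lift_ι _ _
    have h := congrArg (lift a (𝟙 T) ≫ ·) hmem
    rw [lift_comp_whiskerLeft_mem, lift_comp_whiskerLeft_mem, ha, fibre, ← curry_natural_left,
      ← curry_natural_left, uncurry_curry] at h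
    simp only [← Category.assoc, lift_whiskerLeft, lift_whiskerRight, Category.id_comp] at h
    rw [(lift_comp_eqPred_iff _ _).2 rfl] at h
    exact ((lift_comp_eqPred_iff _ _).1 h.symm).symm

end Topos

open MonObj

variable [CartesianMonoidalCategory E] [BraidedCategory E]

/-! ### The additive structure of abelian group objects -/

/-- Abelian group objects form a preadditive category. The group operation of an object is written
multiplicatively, so the sum of two morphisms of group objects is their pointwise product. -/
instance : Preadditive (CommGrp E) where
  homGroup A B := Equiv.addCommGroup (β := Additive (A.toGrp ⟶ B.toGrp))
    (InducedCategory.homEquiv.trans Additive.ofMul)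
  add_comp A B C f f' g := by
    ext
    exact mul_comp f.hom.hom.hom f'.hom.hom.hom g.hom.hom.hom
  comp_add A B C f g g' := by
    ext
    exact comp_mul f.hom.hom.hom g.hom.hom.hom g'.hom.hom.hom

@[simp]
lemma zero_hom_hom_hom (A B : CommGrp E) : (0 : A ⟶ B).hom.hom.hom = 1 := rfl

/-- A morphism of abelian group objects from a compatible morphism of underlying objects. -/
def homMk {A B : CommGrp E} (f : A.X ⟶ B.X) [IsMonHom f] : A ⟶ B :=
  InducedCategory.homMk (Grp.homMk (A := A.toGrp) (B := B.toGrp) f)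

lemma hom_comp_hom_hom {A B C : CommGrp E} (f : A ⟶ B) (g : B ⟶ C) :
    (f ≫ g).hom.hom.hom = f.hom.hom.hom ≫ g.hom.hom.hom := rfl

instance : HasFiniteProducts (CommGrp E) := by
  have (A B : CommGrp E) : HasLimit (pair A B) := by
    let P : CommGrp E := ⟨A.X ⊗ B.X⟩
    let p₁ : P ⟶ A := InducedCategory.homMk (fst A.toGrp B.toGrp)
    let p₂ : P ⟶ B := InducedCategory.homMk (snd A.toGrp B.toGrp)
    refine ⟨⟨⟨BinaryFan.mk p₁ p₂, BinaryFan.IsLimit.mk _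
      (fun {T} f g ↦ (InducedCategory.homMk (lift f.hom g.hom) : T ⟶ P)) ?_ ?_ ?_⟩⟩⟩
    · intro T f g
      ext
      exact lift_fst _ _
    · intro T f g
      ext
      exact lift_snd _ _
    · rintro T f g m rfl rfl
      ext
      exact CartesianMonoidalCategory.hom_ext _ _ (lift_fst _ _).symm (lift_snd _ _).symm
  have : HasBinaryProducts (CommGrp E) := hasBinaryProducts_of_hasLimit_pair _
  have : HasTerminal (CommGrp E) := by
    refine IsTerminal.hasTerminal (X := CommGrp.trivial E) (IsTerminal.ofUniqueHom (fun _ ↦ 0) ?_)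
    intro A f
    ext
    exact toUnit_unique _ _
  exact hasFiniteProducts_of_has_binary_and_terminal

/-! ### Kernels -/

omit [BraidedCategory E] in
lemma isMonHom_of_comp_mono {A B C : E} [MonObj A] [MonObj B] [MonObj C] (f : A ⟶ B) (m : B ⟶ C)
    [IsMonHom m] [Mono m] [IsMonHom (f ≫ m)] : IsMonHom f where
  one_hom := by
    rw [← cancel_mono m, Category.assoc, IsMonHom.one_hom, IsMonHom.one_hom]
  mul_hom := by
    rw [← cancel_mono m, Category.assoc, Category.assoc, IsMonHom.mul_hom m,
      IsMonHom.mul_hom (f ≫ m), ← Category.assoc, tensorHom_comp_tensorHom]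

lemma isCommMonObj_of_mono {A B : E} [MonObj A] [MonObj B] [IsCommMonObj B] (m : A ⟶ B)
    [IsMonHom m] [Mono m] : IsCommMonObj A where
  mul_comm := by
    rw [← cancel_mono m, Category.assoc, IsMonHom.mul_hom, ← Category.assoc,
      ← BraidedCategory.braiding_naturality, Category.assoc, IsCommMonObj.mul_comm]

/-- Kernels of abelian group objects: the kernel is injective on generalized elements, and its
generalized elements are those of `A` that `f` maps to the neutral element. -/
theorem exists_kernel [HasFiniteLimits E] {A B : CommGrp E} (f : A ⟶ B) :
    ∃ (K : CommGrp E) (i : K ⟶ A), Mono i.hom.hom.hom ∧ i ≫ f = 0 ∧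
      ∀ (T : E) (t : T ⟶ A.X), t ≫ f.hom.hom.hom = 1 → ∃ s, s ≫ i.hom.hom.hom = t := by
  let i := equalizer.ι f.hom (1 : A.toGrp ⟶ B.toGrp)
  have hmono : Mono i.hom.hom := inferInstanceAs (Mono ((Grp.forget E).map i))
  have : IsCommMonObj (equalizer f.hom (1 : A.toGrp ⟶ B.toGrp)).X := isCommMonObj_of_mono i.hom.hom
  have hi : i.hom.hom ≫ f.hom.hom.hom = 1 := by
    have h := congrArg (fun g ↦ g.hom.hom) (equalizer.condition f.hom (1 : A.toGrp ⟶ B.toGrp))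
    exact h.trans (comp_one i.hom.hom)
  refine ⟨⟨(equalizer f.hom (1 : A.toGrp ⟶ B.toGrp)).X⟩, homMk (B := A) i.hom.hom, hmono, ?_,
    fun T t ht ↦ ?_⟩
  · ext
    exact hi
  · exact ⟨_, (Fork.IsLimit.lift' (isLimitOfHasEqualizerOfPreservesLimit (Grp.forget E)
      f.hom (1 : A.toGrp ⟶ B.toGrp)) t (ht.trans (comp_one t).symm)).2⟩

/-- A factorization through an injective morphism of group objects is one of group objects. -/
lemma exists_hom_lift {A B C : CommGrp E} (m : B ⟶ C) [Mono m.hom.hom.hom] (g : A ⟶ C)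
    (h : ∃ s, s ≫ m.hom.hom.hom = g.hom.hom.hom) : ∃ s, s ≫ m = g := by
  obtain ⟨s, hs⟩ := h
  have : IsMonHom (s ≫ m.hom.hom.hom) := by rw [hs]; infer_instance
  have := isMonHom_of_comp_mono s m.hom.hom.hom
  exact ⟨homMk s, CommGrp.hom_ext _ _ hs⟩

/-- A monomorphism of abelian group objects has trivial kernel, so it is injective on generalized
elements. -/
lemma mono_hom_hom_hom [HasFiniteLimits E] {A B : CommGrp E} (m : A ⟶ B) [Mono m] :
    Mono m.hom.hom.hom where
  right_cancellation {T} x y h := by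
    obtain ⟨K, i, _, hi, hK⟩ := exists_kernel m
    obtain ⟨s, hs⟩ := hK T (x / y) (by rw [GrpObj.div_comp, h, div_self'])
    rw [zero_of_comp_mono m hi, zero_hom_hom_hom, comp_one] at hs
    exact div_eq_one.1 hs.symm

lemma mono_of_mono_hom_hom_hom {A B : CommGrp E} (m : A ⟶ B) [Mono m.hom.hom.hom] : Mono m :=
  (CommGrp.forget E).mono_of_mono_map ‹_›

lemma epi_of_epi_hom_hom_hom {A B : CommGrp E} (q : A ⟶ B) [Epi q.hom.hom.hom] : Epi q :=
  (CommGrp.forget E).epi_of_epi_map ‹_›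

/-! ### Cokernels -/

variable [HasFiniteLimits E] [MonoidalClosed E] [HasSubobjectClassifier E]

omit [HasFiniteLimits E] [HasSubobjectClassifier E] in
lemma isMonHom_of_epi_comp {A B C : E} [MonObj A] [MonObj B] [MonObj C] (q : A ⟶ B) (f : B ⟶ C)
    [IsMonHom q] [Epi q] [IsMonHom (q ≫ f)] : IsMonHom f where
  one_hom := by rw [← IsMonHom.one_hom q, Category.assoc, IsMonHom.one_hom]
  mul_hom := by
    rw [← cancel_epi (q ⊗ₘ q), ← Category.assoc, ← IsMonHom.mul_hom, Category.assoc,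
      IsMonHom.mul_hom (q ≫ f), ← Category.assoc, tensorHom_comp_tensorHom]

/-- The quotient of an abelian group object by a congruence, given as an epimorphism `q` whose
kernel pair is stable under translation: the group operations descend along `q`. -/
theorem exists_quotient_commGrp (B : CommGrp E) {Q : E} (q : B.X ⟶ Q) [Epi q]
    (h : ∀ (T : E) (c x y : T ⟶ B.X), x ≫ q = y ≫ q → (c * x) ≫ q = (c * y) ≫ q) :
    ∃ (Q' : CommGrp E) (q' : B ⟶ Q') (e : Q ≅ Q'.X), q'.hom.hom.hom = q ≫ e.hom := by
  obtain ⟨mul, hmul⟩ := exists_desc (q ⊗ₘ q) (μ[B.X] ≫ q) fun T x y e ↦ by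
    obtain ⟨x, x', rfl⟩ : ∃ a b, x = lift a b := ⟨x ≫ fst _ _, x ≫ snd _ _, by simp⟩
    obtain ⟨y, y', rfl⟩ : ∃ a b, y = lift a b := ⟨y ≫ fst _ _, y ≫ snd _ _, by simp⟩
    rw [lift_map, lift_map] at e
    have e₁ := congrArg (· ≫ fst _ _) e
    have e₂ := congrArg (· ≫ snd _ _) e
    simp only [lift_fst, lift_snd] at e₁ e₂
    rw [← Category.assoc, ← Category.assoc, ← Hom.mul_def, ← Hom.mul_def, h T x x' y' e₂,
      _root_.mul_comm x, h T y' x y e₁, _root_.mul_comm]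
  obtain ⟨inv, hinv⟩ := exists_desc q (ι[B.X] ≫ q) fun T x y e ↦ by
    rw [← Category.assoc, ← Category.assoc, ← Hom.inv_def, ← Hom.inv_def]
    have := h T (x⁻¹ * y⁻¹) x y e
    rw [inv_mul_cancel_right, _root_.mul_comm x⁻¹, inv_mul_cancel_right] at this
    exact this.symm
  have hmul₁ : q ▷ B.X ≫ Q ◁ q ≫ mul = μ[B.X] ≫ q := by
    rw [← hmul, MonoidalCategory.tensorHom_def, Category.assoc]
  have hmul₂ : B.X ◁ q ≫ q ▷ Q ≫ mul = μ[B.X] ≫ q := by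
    rw [← hmul, tensorHom_def', Category.assoc]
  let : MonObj Q :=
    { one := η[B.X] ≫ q
      mul := mul
      one_mul := by
        rw [← cancel_epi (𝟙_ E ◁ q), whisker_exchange_assoc, comp_whiskerRight, Category.assoc,
          hmul₁, MonObj.one_mul_assoc, leftUnitor_naturality]
      mul_one := by
        rw [← cancel_epi (q ▷ 𝟙_ E), ← whisker_exchange_assoc, whiskerLeft_comp, Category.assoc,
          hmul₂, MonObj.mul_one_assoc, rightUnitor_naturality]
      mul_assoc := by
        have h₁ : ((q ⊗ₘ q) ⊗ₘ q) ≫ mul ▷ Q ≫ mul = μ[B.X] ▷ B.X ≫ μ ≫ q := by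
          rw [← tensorHom_id, tensorHom_comp_tensorHom_assoc, hmul, Category.comp_id, ← hmul,
            ← tensorHom_id, tensorHom_comp_tensorHom_assoc, Category.id_comp, hmul]
        have h₂ : (q ⊗ₘ (q ⊗ₘ q)) ≫ Q ◁ mul ≫ mul = B.X ◁ μ[B.X] ≫ μ ≫ q := by
          rw [← id_tensorHom, tensorHom_comp_tensorHom_assoc, hmul, Category.comp_id, ← hmul,
            ← id_tensorHom, tensorHom_comp_tensorHom_assoc, Category.id_comp, hmul]
        rw [← cancel_epi ((q ⊗ₘ q) ⊗ₘ q), h₁, associator_naturality_assoc, h₂,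
          MonObj.mul_assoc_assoc] }
  have : IsMonHom q := ⟨rfl, hmul.symm⟩
  let : GrpObj Q :=
    { inv := inv
      left_inv := by
        have : q ≫ lift inv (𝟙 Q) = lift ι (𝟙 B.X) ≫ (q ⊗ₘ q) := by simp [hinv]
        rw [← cancel_epi q, reassoc_of% this, ← IsMonHom.mul_hom, GrpObj.left_inv_assoc,
          IsMonHom.one_hom, comp_toUnit_assoc]
      right_inv := by
        have : q ≫ lift (𝟙 Q) inv = lift (𝟙 B.X) ι ≫ (q ⊗ₘ q) := by simp [hinv]
        rw [← cancel_epi q, reassoc_of% this, ← IsMonHom.mul_hom, GrpObj.right_inv_assoc,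
          IsMonHom.one_hom, comp_toUnit_assoc] }
  have : IsCommMonObj Q :=
    { mul_comm := by
        rw [← cancel_epi (q ⊗ₘ q), BraidedCategory.braiding_naturality_assoc, ← IsMonHom.mul_hom,
          ← Category.assoc, IsCommMonObj.mul_comm] }
  exact ⟨⟨Q⟩, homMk q, Iso.refl Q, (Category.comp_id q).symm⟩

/-- Cokernels of abelian group objects. The cokernel of `f : A ⟶ B` is the coequalizer, in the
topos, of the translation action `(a, b) ↦ f a * b` and the projection; the congruence property
holds because this coequalizer is preserved by the left adjoint `B ⊗ -`. -/
theorem exists_cokernel {A B : CommGrp E} (f : A ⟶ B) :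
    ∃ (Q : CommGrp E) (q : B ⟶ Q), Epi q.hom.hom.hom ∧ f ≫ q = 0 ∧
      ∀ {Z : E} (g : B.X ⟶ Z), (∀ (T : E) (a : T ⟶ A.X) (b : T ⟶ B.X),
        (a ≫ f.hom.hom.hom * b) ≫ g = b ≫ g) → ∃ u, q.hom.hom.hom ≫ u = g := by
  obtain ⟨Q, q, _, hq, desc⟩ :=
    exists_coequalizer (fst A.X B.X ≫ f.hom.hom.hom * snd A.X B.X) (snd A.X B.X)
  have hq' (T : E) (a : T ⟶ A.X) (b : T ⟶ B.X) : (a ≫ f.hom.hom.hom * b) ≫ q = b ≫ q := by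
    simpa [← Category.assoc, comp_mul] using congrArg (lift a b ≫ ·) hq
  -- `k` sends the class of `b` to the morphism `c ↦ q (c * b)`, which witnesses the congruence
  obtain ⟨k, hk⟩ := desc (curry (μ[B.X] ≫ q)) (by
    rw [← curry_natural_left, ← curry_natural_left]
    have h (x : A.X ⊗ B.X ⟶ B.X) : B.X ◁ x ≫ μ[B.X] = fst B.X _ * (snd B.X _ ≫ x) := by
      rw [Hom.mul_def]
      congr 1
      ext <;> simp
    rw [← Category.assoc, ← Category.assoc, h, h, comp_mul, mul_left_comm, ← Category.assoc,
      hq'])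
  obtain ⟨Q', q', e, he⟩ := exists_quotient_commGrp B q fun T c x y hxy ↦ by
    have key (z : T ⟶ B.X) : (c * z) ≫ q = lift c (𝟙 T) ≫ uncurry ((z ≫ q) ≫ k) := by
      rw [Category.assoc, hk, ← curry_natural_left, uncurry_curry, Hom.mul_def]
      simp [← Category.assoc]
    rw [key, key, hxy]
  refine ⟨Q', q', ?_, ?_, fun {Z} g hg ↦ ?_⟩
  · rw [he]
    infer_instance
  · ext
    have := hq' A.X (𝟙 _) 1
    rw [hom_comp_hom_hom, zero_hom_hom_hom, ← one_comp (X := A.X) q'.hom.hom.hom, he]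
    simpa using congrArg (· ≫ e.hom) this
  · obtain ⟨u, hu⟩ := desc g (by
      simpa using hg (A.X ⊗ B.X) (fst _ _) (snd _ _))
    exact ⟨e.inv ≫ u, by rw [he, Category.assoc, e.hom_inv_id_assoc, hu]⟩

omit [HasFiniteLimits E] [HasSubobjectClassifier E] in
/-- The universal property of the cokernel among abelian group objects, for `q` as provided by
`exists_cokernel`. -/
lemma exists_hom_desc {A B Q Z : CommGrp E} {f : A ⟶ B} {q : B ⟶ Q} [Epi q.hom.hom.hom]
    (desc : ∀ {Z : E} (g : B.X ⟶ Z), (∀ (T : E) (a : T ⟶ A.X) (b : T ⟶ B.X),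
      (a ≫ f.hom.hom.hom * b) ≫ g = b ≫ g) → ∃ u, q.hom.hom.hom ≫ u = g)
    (g : B ⟶ Z) (hg : f ≫ g = 0) : ∃ u, q ≫ u = g := by
  have hg' : f.hom.hom.hom ≫ g.hom.hom.hom = 1 := by rw [← hom_comp_hom_hom, hg, zero_hom_hom_hom]
  obtain ⟨u, hu⟩ := desc g.hom.hom.hom fun T a b ↦ by
    rw [mul_comp, Category.assoc, hg', comp_one, _root_.one_mul]
  have : IsMonHom (q.hom.hom.hom ≫ u) := by rw [hu]; infer_instance
  have := isMonHom_of_epi_comp q.hom.hom.hom u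
  exact ⟨homMk u, CommGrp.hom_ext _ _ hu⟩

/-! ### Normality of monomorphisms and epimorphisms -/

/-- A monomorphism `m : A ⟶ B` is the kernel of its cokernel `q`. The morphism sending `b : B` to
its coset, as a subobject of `B`, is invariant under translation by `A`, so it factors through `q`;
hence elements of `B` killed by `q` have the same coset as the neutral element. -/
lemma exists_lift_of_comp_cokernel {A B Q : CommGrp E} (m : A ⟶ B) [Mono m] (q : B ⟶ Q)
    (desc : ∀ {Z : E} (g : B.X ⟶ Z), (∀ (T : E) (a : T ⟶ A.X) (b : T ⟶ B.X),
      (a ≫ m.hom.hom.hom * b) ≫ g = b ≫ g) → ∃ u, q.hom.hom.hom ≫ u = g)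
    {T : E} (b : T ⟶ B.X) (hb : b ≫ q.hom.hom.hom = 1) : ∃ s, s ≫ m.hom.hom.hom = b := by
  have := mono_hom_hom_hom m
  let coset : B.X ⟶ (ihom B.X).obj (Ω E) :=
    curry ((fst B.X B.X / snd B.X B.X) ≫ χ m.hom.hom.hom)
  obtain ⟨u, hu⟩ := desc coset fun T a b ↦ by
    rw [← curry_natural_left, ← curry_natural_left]
    congr 1
    refine hom_Ω_ext fun S x ↦ ?_
    obtain ⟨c, t, rfl⟩ : ∃ c t, x = lift c t := ⟨x ≫ fst _ _, x ≫ snd _ _, by simp⟩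
    simp only [← Category.assoc, lift_whiskerLeft, GrpObj.comp_div, comp_mul, lift_fst, lift_snd,
      comp_χ_eq_trueAt_iff]
    constructor
    · rintro ⟨y, hy⟩
      refine ⟨y * t ≫ a, ?_⟩
      rw [mul_comp, hy, Category.assoc]
      rw [div_mul_eq_div_div_swap, div_mul_cancel]
    · rintro ⟨y, hy⟩
      refine ⟨y / t ≫ a, ?_⟩
      rw [GrpObj.div_comp, hy, Category.assoc]
      exact (div_mul_eq_div_div_swap _ _ _).symm
  have hcoset : b ≫ coset = (1 : T ⟶ B.X) ≫ coset := by
    rw [← hu, ← Category.assoc, ← Category.assoc, hb, one_comp q.hom.hom.hom]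
  rw [← curry_natural_left, ← curry_natural_left] at hcoset
  have h := congrArg (lift b (𝟙 T) ≫ ·) (curry_injective hcoset)
  simp only [← Category.assoc, lift_whiskerLeft, GrpObj.comp_div, lift_fst, lift_snd,
    Category.id_comp, div_self', div_one] at h
  rw [← comp_χ_eq_trueAt_iff]
  refine h.symm.trans ?_
  rw [comp_χ_eq_trueAt_iff]
  exact ⟨1, one_comp _⟩

/-- A morphism of abelian group objects that is both a monomorphism and an epimorphism has zero
cokernel, so by normality of monomorphisms it is split. -/
lemma isIso_of_mono_of_epi_commGrp {A B : CommGrp E} (m : A ⟶ B) [Mono m] [Epi m] : IsIso m := by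
  obtain ⟨Q, q, _, hq, desc⟩ := exists_cokernel m
  have := mono_hom_hom_hom m
  obtain ⟨s, hs⟩ := exists_lift_of_comp_cokernel m q desc (𝟙 B.X) (by
    rw [zero_of_epi_comp m hq, zero_hom_hom_hom, comp_one])
  obtain ⟨r, hr⟩ := exists_hom_lift m (𝟙 B) ⟨s, hs⟩
  have : IsSplitEpi m := ⟨⟨r, hr⟩⟩
  exact isIso_of_mono_of_isSplitEpi m

instance : HasKernels (CommGrp E) where
  has_limit {A B} f := by
    obtain ⟨K, i, _, hi, hK⟩ := exists_kernel f
    have := mono_of_mono_hom_hom_hom i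
    exact ⟨⟨⟨_, KernelFork.IsLimit.ofι' i hi fun g hg ↦
      ⟨_, (exists_hom_lift i g (hK _ _ (by rw [← hom_comp_hom_hom, hg, zero_hom_hom_hom]))
        ).choose_spec⟩⟩⟩⟩

instance : HasCokernels (CommGrp E) where
  has_colimit {A B} f := by
    obtain ⟨Q, q, _, hq, desc⟩ := exists_cokernel f
    have := epi_of_epi_hom_hom_hom q
    exact ⟨⟨⟨_, CokernelCofork.IsColimit.ofπ' q hq fun g hg ↦
      ⟨_, (exists_hom_desc desc g hg).choose_spec⟩⟩⟩⟩

instance : IsNormalMonoCategory (CommGrp E) where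
  normalMonoOfMono {A B} m _ := by
    obtain ⟨Q, q, _, hq, desc⟩ := exists_cokernel m
    have := mono_hom_hom_hom m
    exact ⟨⟨Q, q, hq, KernelFork.IsLimit.ofι' m hq fun g hg ↦
      ⟨_, (exists_hom_lift m g (exists_lift_of_comp_cokernel m q desc _ (by
        rw [← hom_comp_hom_hom, hg, zero_hom_hom_hom]))).choose_spec⟩⟩⟩

/-- An epimorphism `e : A ⟶ B` is the cokernel of its kernel `i : K ⟶ A`. The induced morphism from
the cokernel of `i` to `B` is a monomorphism, because `e` and the quotient map have the same kernel
pair, and it is an epimorphism since `e` is. -/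
instance : IsNormalEpiCategory (CommGrp E) where
  normalEpiOfEpi {A B} e _ := by
    obtain ⟨K, i, _, hi, hK⟩ := exists_kernel e
    obtain ⟨Q, q, _, hq, desc⟩ := exists_cokernel i
    obtain ⟨m, rfl⟩ := exists_hom_desc desc e hi
    have : Mono m.hom.hom.hom := by
      refine mono_of_kernelPair_le q.hom.hom.hom _ fun T x y hxy ↦ ?_
      obtain ⟨s, hs⟩ := hK T (x / y) (by
        rw [GrpObj.div_comp, hom_comp_hom_hom, hxy, div_self'])
      have hiq : i.hom.hom.hom ≫ q.hom.hom.hom = 1 := by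
        rw [← hom_comp_hom_hom, hq, zero_hom_hom_hom]
      rw [← div_mul_cancel x y, ← hs, mul_comp, Category.assoc, hiq, comp_one, _root_.one_mul]
    have := mono_of_mono_hom_hom_hom m
    have := epi_of_epi q m
    have := isIso_of_mono_of_epi_commGrp m
    exact ⟨⟨K, i, hi, CokernelCofork.IsColimit.ofπ' (q ≫ m) hi fun g hg ↦
      ⟨inv m ≫ (exists_hom_desc desc g hg).choose, by
        rw [Category.assoc, IsIso.hom_inv_id_assoc, (exists_hom_desc desc g hg).choose_spec]⟩⟩⟩

end ElementaryTopos

theorem mainTheorem1 (E : Type u) [Category.{v} E]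
    [CartesianMonoidalCategory E] [BraidedCategory E]
    [HasFiniteLimits E] [MonoidalClosed E] [HasSubobjectClassifier E] :
    Nonempty (Abelian (CommGrp E)) :=
  ⟨{}⟩
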